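/- Let $\mathcal C$ be a locally small category in which $\hom_{\mathcal C}(c,c')\neq\emptyset$ for all objects $c,c'$ (that is, $\mathcal C$ is strongly connected) and in which any two objects have a coproduct. Assume that the category $\mathrm{Ab}^{\mathcal C}$ of functors $\mathcal C\to\mathrm{Ab}$ has enough injective objects (which is automatic if $\mathcal C$ is small), and let $\lim^n=\mathbb R^n\lim$ be the right derived functors of $\lim:\mathrm{Ab}^{\mathcal C}\to\mathrm{Ab}$. For an object $c$ let $\mathrm B(c)$ be the cosimplicial object of $\mathcal C$ with $\mathrm B(c)^n=c^{\sqcup(n+1)}=\bigsqcup_{j=0}^n c$, in which a monotone map $f:[n]\to[m]$ acts by $(i_{f(0)},\dots,i_{f(n)}):\bigsqcup_{j=0}^n c\to\bigsqcup_{k=0}^m c$, where $i_k$ are the canonical inclusions. For a cosimplicial abelian group $A$ let $\pi^nA$ be the $n$-th cohomology group of the cochain complex with terms $A^n$ and differential $\sum_{j=0}^{n+1}(-1)^jd^j$. Then for every functor $\mathcal F:\mathcal C\to\mathrm{Ab}$, every object $c$ of $\mathcal C$ and every $n\ge 0$ there is an isomorphism $$\lim\nolimits^n\mathcal F\;\cong\;\pi^n\,\mathcal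 F\,\mathrm B(c),$$ natural in $\mathcal F$ and in $c$ (where $\lim^n\mathcal F$ is regarded as constant in $c$). -/

import Mathlib

open CategoryTheory CategoryTheory.Limits

universe w v u

namespace HigherLimits

/-- A category is strongly connected if every hom-set is nonempty. -/
class IsStronglyConnected (C : Type u) [Category.{v} C] : Prop where
  nonempty_hom : ∀ c c' : C, Nonempty (c ⟶ c')

section Coproducts

variable {C : Type u} [Category.{v} C] [HasBinaryCoproducts C]

/-- In a category with pairwise coproducts, finite nonempty families have coproducts. -/
theorem hasCoproduct_fin_succ : ∀ (n : ℕ) (f : Fin (n + 1) → C), HasCoproduct f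
  | 0 => fun f => inferInstanceAs (HasCoproduct (β := Fin 1) f)
  | n + 1 => fun f =>
    have := hasCoproduct_fin_succ n
    HasColimit.mk ⟨_, extendCofanIsColimit f (colimit.isColimit _) (colimit.isColimit _)⟩

instance (n : ℕ) (f : Fin (n + 1) → C) : HasCoproduct f := hasCoproduct_fin_succ n f

/-- The `(n + 1)`-fold copower `c ⊔ ⋯ ⊔ c`. -/
noncomputable abbrev copower (c : C) (n : ℕ) : C := ∐ fun _ : Fin (n + 1) => c

/-- The standard cosimplicial object `B(c)`: `B(c)ⁿ` is the `(n + 1)`-fold copower of `c`, and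
a monotone map `f : [n] → [m]` is sent to the map `(i_{f 0}, …, i_{f n})`. -/
noncomputable def standardComplexObj (c : C) : CosimplicialObject C where
  obj n := copower c n.len
  map {n m} f := Sigma.desc fun j : Fin (n.len + 1) =>
    Sigma.ι (fun _ : Fin (m.len + 1) => c) (f.toOrderHom j)

variable (C) in
/-- The standard cosimplicial object, as a functor of the object `c`: a morphism `f : c ⟶ c'` is
sent to `f ⊔ ⋯ ⊔ f` in each degree. -/
noncomputable def standardComplex : C ⥤ CosimplicialObject C where
  obj c := standardComplexObj c
  map {c c'} f :=
    { app := fun n => Limits.Sigma.map fun _ => f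
      naturality := by
        intro n m g
        apply Sigma.hom_ext
        intro j
        simp [standardComplexObj] }
  map_id c := by
    ext n
    apply Sigma.hom_ext
    intro j
    simp [standardComplexObj]
  map_comp {c₁ c₂ c₃} f g := by
    ext n
    apply Sigma.hom_ext
    intro j
    change Sigma.ι (fun _ : Fin (n.len + 1) => c₁) j ≫ (Limits.Sigma.map fun _ => f ≫ g) =
      Sigma.ι (fun _ : Fin (n.len + 1) => c₁) j ≫ (Limits.Sigma.map fun _ => f) ≫
        Limits.Sigma.map fun _ => g
    simp

end Coproducts

section Cohomotopy

/-- The cohomotopy groups `πⁿ A = Hⁿ(CA)` of a cosimplicial abelian group `A`, where `CA` is the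
alternate sum complex: `(CA)ⁿ = Aⁿ` with differential `∑ⱼ (-1)ʲ dʲ`. -/
noncomputable def cohomotopy (n : ℕ) : CosimplicialObject AddCommGrpCat.{w} ⥤ AddCommGrpCat.{w} :=
  AlgebraicTopology.alternatingCofaceMapComplex AddCommGrpCat.{w} ⋙
    HomologicalComplex.homologyFunctor AddCommGrpCat.{w} (ComplexShape.up ℕ) n

/-- The functor `c ↦ (F ↦ πⁿ F B(c))`. -/
noncomputable def standardCohomotopy (C : Type u) [Category.{v} C] [HasBinaryCoproducts C] (n : ℕ) :
    C ⥤ (C ⥤ AddCommGrpCat.{w}) ⥤ AddCommGrpCat.{w} :=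
  standardComplex C ⋙ Functor.whiskeringLeft SimplexCategory C AddCommGrpCat.{w} ⋙
    (Functor.whiskeringRight _ _ _).obj (cohomotopy n)

end Cohomotopy

section Lim

variable {C : Type u} [Category.{v} C]

/-- In a strongly connected category with pairwise coproducts, `c ⇉ c ⊔ c` is an initial diagram,
so that limits over the category are equalizers. -/
theorem initial_parallelPair [IsStronglyConnected C] [HasBinaryCoproducts C] (c : C) :
    (parallelPair (coprod.inl : c ⟶ c ⨿ c) coprod.inr).Initial where
  out d := by
    obtain ⟨g⟩ := IsStronglyConnected.nonempty_hom c d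
    let P := parallelPair (coprod.inl : c ⟶ c ⨿ c) coprod.inr
    let z (h : c ⟶ d) : CostructuredArrow P d :=
      CostructuredArrow.mk (Y := WalkingParallelPair.zero) (S := P) h
    let o (h : c ⨿ c ⟶ d) : CostructuredArrow P d :=
      CostructuredArrow.mk (Y := WalkingParallelPair.one) (S := P) h
    have hl (h : c ⨿ c ⟶ d) : z (coprod.inl ≫ h) ⟶ o h :=
      CostructuredArrow.homMk WalkingParallelPairHom.left (by simp [z, o, P])
    have hr (h : c ⨿ c ⟶ d) : z (coprod.inr ≫ h) ⟶ o h :=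
      CostructuredArrow.homMk WalkingParallelPairHom.right (by simp [z, o, P])
    have hz (h : c ⟶ d) : Zigzag (z g) (z h) := by
      have h1 := Zigzag.of_hom (hl (coprod.desc g h))
      have h2 := Zigzag.of_inv (hr (coprod.desc g h))
      rw [coprod.inl_desc] at h1
      rw [coprod.inr_desc] at h2
      exact h1.trans h2
    have key (X : CostructuredArrow P d) : Zigzag (z g) X := by
      obtain ⟨Y, ⟨⟨⟩⟩, h⟩ := X
      cases Y
      · exact hz h
      · exact (hz _).trans (Zigzag.of_hom (hl h))
    have : Nonempty (CostructuredArrow P d) := ⟨z g⟩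
    exact zigzag_isConnected fun X Y => (key X).symm.trans (key Y)

/-- A strongly connected category with pairwise coproducts (of any size) has limits of functors
to abelian groups. -/
instance [IsStronglyConnected C] [HasBinaryCoproducts C] :
    HasLimitsOfShape C AddCommGrpCat.{w} := by
  rcases isEmpty_or_nonempty C with h | ⟨⟨c⟩⟩
  · exact hasLimitsOfShape_of_equivalence (equivalenceOfIsEmpty (Discrete PEmpty.{1}) C)
  · have := initial_parallelPair c
    exact Functor.Initial.hasLimitsOfShape_of_initial
      (parallelPair (coprod.inl : c ⟶ c ⨿ c) coprod.inr)

instance [HasLimitsOfShape C AddCommGrpCat.{w}] :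
    (lim : (C ⥤ AddCommGrpCat.{w}) ⥤ AddCommGrpCat.{w}).Additive where
  map_add {F G f g} := by
    apply limit.hom_ext
    intro j
    simp

end Lim

/-- The higher limits `limⁿ`: the right derived functors of `lim : Ab^C ⥤ Ab`. -/
noncomputable def higherLim (C : Type u) [Category.{v} C] [HasLimitsOfShape C AddCommGrpCat.{w}]
    [EnoughInjectives (C ⥤ AddCommGrpCat.{w})] (n : ℕ) :
    (C ⥤ AddCommGrpCat.{w}) ⥤ AddCommGrpCat.{w} :=
  (lim : (C ⥤ AddCommGrpCat.{w}) ⥤ AddCommGrpCat.{w}).rightDerived n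

end HigherLimits

/-!
For a fixed object `c`, the functor `K_c : F ↦ C F B(c)` from `Ab^C` to cochain complexes is exact,
since each of its terms is an evaluation functor. Two further properties make its cohomology the
right derived functors of `lim`.

* `limIso`: `H⁰ ∘ K_c ≅ lim`. A cocycle in `F (B(c)⁰)` has the same image in `F d` under any two
  morphisms `B(c)⁰ ⟶ d`, because these factor through the two coface maps to `B(c)¹`; so it defines
  a compatible family, morphisms `B(c)⁰ ⟶ d` existing for all `d` by strong connectedness.
* `standardCochain_exactAt_succ`: `K_c I` is exact in positive degrees for `I` injective. By the
  Yoneda lemma `I (B(c)ⁿ) = Hom(ℤ[Hom(B(c)ⁿ, -)], I)`, and the complex of functors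
  `ℤ[Hom(B(c)ⁿ, -)]` is exact in positive degrees: at `d` its basis in degree `n` is the set of
  `(n + 1)`-tuples of elements of the nonempty set `Hom(c, d)`, and putting a fixed element in front
  of each tuple is a contraction (`freeCoyonedaContraction_homotopy`).

The comparison for an arbitrary exact `K` with the second property is
`IsResolving.rightDerivedIso`. For an injective resolution `I` of `F`, the bicomplex `K I` is exact
in both directions away from its edges, and `H⁰ (K Iᵖ) = L Iᵖ` for `L = H⁰ ∘ K`. The short exact
sequences `0 ⟶ Zᵖ ⟶ K Iᵖ ⟶ Zᵖ⁺¹ ⟶ 0` shift degrees, `Hⁿ⁺¹ (Z⁰) ≅ ⋯ ≅ H¹ (Zⁿ)`, where `Z⁰ = K F`;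
and both `H¹ (Zⁿ)` and `Hⁿ⁺¹ (L I)` are the cokernel of `H⁰ (K Iⁿ) ⟶ H⁰ (Zⁿ⁺¹)`
(`IsEdgeExact.edgeIso`). Every step is natural in the bicomplex, hence in `F` and,
through `K_c`, in `c`.
-/

namespace HigherLimits

open Opposite

/-! ### Cocycles and left exact functors -/

section Cycles

variable {A B : Type*} [Category* A] [Category* B] [Abelian A] [Abelian B]

/-- The comparison `F (Zᵖ D) ⟶ Zᵖ (F D)` for an additive functor `F` and a cochain complex `D`. -/
noncomputable def mapCyclesComparison (F : A ⥤ B) [F.Additive] (D : CochainComplex A ℕ) (p : ℕ) :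
    F.obj (D.cycles p) ⟶ ((F.mapHomologicalComplex (ComplexShape.up ℕ)).obj D).cycles p :=
  HomologicalComplex.liftCycles _ (F.map (D.iCycles p)) (p + 1) (by simp)
    ((F.map_comp _ _).symm.trans
      ((congrArg F.map (D.iCycles_d p (p + 1))).trans (F.map_zero _ _)))

lemma mapCyclesComparison_iCycles (F : A ⥤ B) [F.Additive] (D : CochainComplex A ℕ) (p : ℕ) :
    mapCyclesComparison F D p ≫
      ((F.mapHomologicalComplex (ComplexShape.up ℕ)).obj D).iCycles p = F.map (D.iCycles p) :=
  HomologicalComplex.liftCycles_i _ _ _ _ _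

lemma mapCyclesComparison_naturality (F : A ⥤ B) [F.Additive] {D D' : CochainComplex A ℕ}
    (φ : D ⟶ D') (p : ℕ) :
    F.map (HomologicalComplex.cyclesMap φ p) ≫ mapCyclesComparison F D' p =
      mapCyclesComparison F D p ≫
        HomologicalComplex.cyclesMap ((F.mapHomologicalComplex (ComplexShape.up ℕ)).map φ) p := by
  rw [← cancel_mono (HomologicalComplex.iCycles _ p), Category.assoc, Category.assoc,
    HomologicalComplex.cyclesMap_i, mapCyclesComparison_iCycles,
    reassoc_of% mapCyclesComparison_iCycles F D p]
  exact (F.map_comp _ _).symm.trans ((congrArg F.map (HomologicalComplex.cyclesMap_i φ p)).trans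
    (F.map_comp _ _))

instance isIso_mapCyclesComparison (F : A ⥤ B) [F.Additive] [PreservesFiniteLimits F]
    (D : CochainComplex A ℕ) (p : ℕ) : IsIso (mapCyclesComparison F D p) := by
  let E := (F.mapHomologicalComplex (ComplexShape.up ℕ)).obj D
  have h₁ := KernelFork.mapIsLimit _ (D.cyclesIsKernel p (p + 1) (by simp)) F
  have h₂ : IsLimit (KernelFork.ofι (f := F.map (D.d p (p + 1))) (E.iCycles p)
    (E.iCycles_d p (p + 1))) := E.cyclesIsKernel p (p + 1) (by simp)
  have : mapCyclesComparison F D p = (h₁.conePointUniqueUpToIso h₂).hom :=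
    (cancel_mono (E.iCycles p)).mp ((mapCyclesComparison_iCycles F D p).trans
      (h₁.conePointUniqueUpToIso_hom_comp h₂ WalkingParallelPair.zero).symm)
  rw [this]
  exact (h₁.conePointUniqueUpToIso h₂).isIso_hom

/-- In degree `0` cohomology is the kernel of the first differential, so it is left exact. -/
instance preservesFiniteLimits_homologyFunctor_zero :
    PreservesFiniteLimits (HomologicalComplex.homologyFunctor B (ComplexShape.up ℕ) 0) := by
  apply ((Functor.preservesFiniteLimits_tfae
    (HomologicalComplex.homologyFunctor B (ComplexShape.up ℕ) 0)).out 0 3).mp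
  intro S hS
  refine ⟨hS.homology_exact₂ 0, ?_⟩
  have := hS.mono_f
  have h : (CochainComplex.isoHomologyπ₀ S.X₁).hom ≫ HomologicalComplex.homologyMap S.f 0 =
      HomologicalComplex.cyclesMap S.f 0 ≫ (CochainComplex.isoHomologyπ₀ S.X₂).hom := by
    simp
  have : Mono ((CochainComplex.isoHomologyπ₀ S.X₁).hom ≫
      HomologicalComplex.homologyMap S.f 0) := by
    rw [h]; infer_instance
  exact (mono_comp_iff_of_isIso (CochainComplex.isoHomologyπ₀ S.X₁).hom _).mp this

/-- The sequence `Zᵖ D ⟶ Dᵖ ⟶ Zᵖ⁺¹ D` of a cochain complex `D`. -/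
noncomputable abbrev cyclesShortComplex (D : CochainComplex A ℕ) (p : ℕ) : ShortComplex A :=
  ShortComplex.mk (D.iCycles p) (D.toCycles p (p + 1))
    (by simp [← cancel_mono (D.iCycles (p + 1))])

/-- The morphism of sequences `Zᵖ ⟶ Dᵖ ⟶ Zᵖ⁺¹` induced by a morphism of cochain complexes. -/
noncomputable abbrev cyclesShortComplexMap {D D' : CochainComplex A ℕ} (φ : D ⟶ D') (p : ℕ) :
    cyclesShortComplex D p ⟶ cyclesShortComplex D' p :=
  ShortComplex.homMk (HomologicalComplex.cyclesMap φ p) (φ.f p)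
    (HomologicalComplex.cyclesMap φ (p + 1)) (by simp)
    (by simp [← cancel_mono (D'.iCycles (p + 1))])

lemma cyclesShortComplex_shortExact {D : CochainComplex A ℕ} {p : ℕ} (h : D.ExactAt (p + 1)) :
    (cyclesShortComplex D p).ShortExact where
  mono_f := by dsimp; infer_instance
  epi_g := by
    have h' := ((D.exactAt_iff' p (p + 1) (p + 2) (by simp) (by simp)).mp h).epi_toCycles
    rw [← D.toCycles_cyclesIsoSc'_hom p (p + 1) (p + 2) (by simp) (by simp)] at h'
    exact (epi_comp_iff_of_isIso _ (D.cyclesIsoSc' p (p + 1) (p + 2) _ _).hom).mp h'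
  exact := by
    refine ShortComplex.exact_of_f_is_kernel _ (KernelFork.IsLimit.ofι' _ _ fun {W} k hk => ?_)
    refine ⟨D.liftCycles k (p + 1) (by simp) ?_, D.liftCycles_i k _ _ _⟩
    rw [← D.toCycles_i p (p + 1), reassoc_of% hk, zero_comp]

lemma map_toCycles_mapCyclesComparison (F : A ⥤ B) [F.Additive] (D : CochainComplex A ℕ) (p q : ℕ) :
    F.map (D.toCycles p q) ≫ mapCyclesComparison F D q =
      ((F.mapHomologicalComplex (ComplexShape.up ℕ)).obj D).toCycles p q := by
  refine (cancel_mono (HomologicalComplex.iCycles _ q)).mp ?_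
  refine (Category.assoc _ _ _).trans ?_
  refine (F.map (D.toCycles p q) ≫= mapCyclesComparison_iCycles F D q).trans ?_
  refine ((F.map_comp _ _).symm.trans (congrArg F.map (D.toCycles_i p q))).trans ?_
  exact (((F.mapHomologicalComplex (ComplexShape.up ℕ)).obj D).toCycles_i p q).symm

/-- The sequence `F (Dᵖ) ⟶ F (Zᵖ⁺¹ D) ⟶ Hᵖ⁺¹ (F D)`. -/
noncomputable abbrev mapCyclesShortComplex (F : A ⥤ B) [F.Additive] (D : CochainComplex A ℕ)
    (p : ℕ) : ShortComplex B :=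
  ShortComplex.mk (F.map (D.toCycles p (p + 1)))
    (mapCyclesComparison F D (p + 1) ≫
      ((F.mapHomologicalComplex (ComplexShape.up ℕ)).obj D).homologyπ (p + 1))
    (by
      refine (Category.assoc _ _ _).symm.trans ?_
      refine (map_toCycles_mapCyclesComparison F D p (p + 1) =≫ _).trans ?_
      exact HomologicalComplex.toCycles_comp_homologyπ _ _ _)

instance (F : A ⥤ B) [F.Additive] [PreservesFiniteLimits F] (D : CochainComplex A ℕ) (p : ℕ) :
    Epi (mapCyclesShortComplex F D p).g := by
  dsimp only
  infer_instance

/-- For left exact `F`, the group `F (Zᵖ⁺¹ D)` is the group of cocycles of `F D`, so that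
`Hᵖ⁺¹ (F D)` is its quotient by the image of `F (Dᵖ)`. -/
lemma mapCyclesShortComplex_exact (F : A ⥤ B) [F.Additive] [PreservesFiniteLimits F]
    (D : CochainComplex A ℕ) (p : ℕ) : (mapCyclesShortComplex F D p).Exact := by
  let E := (F.mapHomologicalComplex (ComplexShape.up ℕ)).obj D
  let T : ShortComplex B := ShortComplex.mk (E.toCycles p (p + 1)) (E.homologyπ (p + 1)) (by simp)
  have hE : T.Exact :=
    ShortComplex.exact_of_g_is_cokernel _ (E.homologyIsCokernel p (p + 1) (by simp))
  let e : mapCyclesShortComplex F D p ≅ T :=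
    ShortComplex.isoMk (Iso.refl (F.obj (D.X p))) (asIso (mapCyclesComparison F D (p + 1)))
      (Iso.refl (E.homology (p + 1)))
      ((Category.id_comp _).trans (map_toCycles_mapCyclesComparison F D p (p + 1)).symm)
      (Category.comp_id _).symm
  exact ShortComplex.exact_of_iso e.symm hE

lemma mapCyclesShortComplex_g_naturality (F : A ⥤ B) [F.Additive] {D D' : CochainComplex A ℕ}
    (φ : D ⟶ D') (p : ℕ) :
    F.map (HomologicalComplex.cyclesMap φ (p + 1)) ≫ (mapCyclesShortComplex F D' p).g =
      (mapCyclesShortComplex F D p).g ≫ HomologicalComplex.homologyMap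
        ((F.mapHomologicalComplex (ComplexShape.up ℕ)).map φ) (p + 1) := by
  rw [Category.assoc, HomologicalComplex.homologyπ_naturality]
  refine (Category.assoc _ _ _).symm.trans ?_
  refine (mapCyclesComparison_naturality F φ (p + 1) =≫ _).trans ?_
  exact Category.assoc _ _ _

end Cycles

/-! ### Bicomplexes with exact rows and columns -/

section Bicomplex

variable {B : Type*} [Category* B] [Abelian B]

/-- A bicomplex `D` in the first quadrant, viewed as a complex of complexes, is edge-exact if it is
exact in positive outer degrees and if each complex `Dᵖ` is exact in positive degrees. -/
structure IsEdgeExact (D : CochainComplex (CochainComplex B ℕ) ℕ) : Prop where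
  exactAt_succ (p : ℕ) : D.ExactAt (p + 1)
  exactAt_X_succ (p q : ℕ) : (D.X p).ExactAt (q + 1)

/-- The complex `p ↦ H⁰ (Dᵖ)` of a bicomplex `D`. -/
noncomputable abbrev homologyZeroComplex :
    CochainComplex (CochainComplex B ℕ) ℕ ⥤ CochainComplex B ℕ :=
  (HomologicalComplex.homologyFunctor B (ComplexShape.up ℕ) 0).mapHomologicalComplex
    (ComplexShape.up ℕ)

namespace IsEdgeExact

variable {D D' : CochainComplex (CochainComplex B ℕ) ℕ} (hD : IsEdgeExact D) (hD' : IsEdgeExact D')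

include hD in
lemma shortExact (p : ℕ) : (cyclesShortComplex D p).ShortExact :=
  cyclesShortComplex_shortExact (hD.exactAt_succ p)

/-- The connecting homomorphism `Hⁿ (Zᵖ⁺¹ D) ⟶ Hⁿ⁺¹ (Zᵖ D)`. -/
noncomputable def connecting (p n : ℕ) :
    (D.cycles (p + 1)).homology n ⟶ (D.cycles p).homology (n + 1) :=
  (hD.shortExact p).δ n (n + 1) (by simp)

lemma connecting_naturality (φ : D ⟶ D') (p n : ℕ) :
    hD.connecting p n ≫ HomologicalComplex.homologyMap (HomologicalComplex.cyclesMap φ p) (n + 1) =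
      HomologicalComplex.homologyMap (HomologicalComplex.cyclesMap φ (p + 1)) n ≫
        hD'.connecting p n :=
  HomologicalComplex.HomologySequence.δ_naturality (cyclesShortComplexMap φ p)
    (hD.shortExact p) (hD'.shortExact p) n (n + 1) (by simp)

instance (p n : ℕ) : Epi (hD.connecting p n) :=
  (hD.shortExact p).epi_δ _ _ _ (hD.exactAt_X_succ p n).isZero_homology

instance (p n : ℕ) : IsIso (hD.connecting p (n + 1)) :=
  (hD.shortExact p).isIso_δ _ _ _ (hD.exactAt_X_succ p n).isZero_homology
    (hD.exactAt_X_succ p (n + 1)).isZero_homology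

/-- The isomorphism `H¹ (Zᵖ D) ≅ Hᵖ⁺¹ (H⁰ D)`: both sides are cokernels of
`H⁰ (Dᵖ) ⟶ H⁰ (Zᵖ⁺¹ D)`. -/
noncomputable def edgeIsoOne (p : ℕ) :
    (D.cycles p).homology 1 ≅ (homologyZeroComplex.obj D).homology (p + 1) :=
  have : Epi (ShortComplex.mk _ _ ((hD.shortExact p).comp_δ 0 1 rfl)).g :=
    inferInstanceAs (Epi (hD.connecting p 0))
  ((hD.shortExact p).homology_exact₃ 0 1 rfl).gIsCokernel.coconePointUniqueUpToIso
    (mapCyclesShortComplex_exact (HomologicalComplex.homologyFunctor B _ 0) D p).gIsCokernel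

lemma connecting_edgeIsoOne_hom (p : ℕ) :
    hD.connecting p 0 ≫ (hD.edgeIsoOne p).hom =
      (mapCyclesShortComplex (HomologicalComplex.homologyFunctor B _ 0) D p).g :=
  have : Epi (ShortComplex.mk _ _ ((hD.shortExact p).comp_δ 0 1 rfl)).g :=
    inferInstanceAs (Epi (hD.connecting p 0))
  IsColimit.comp_coconePointUniqueUpToIso_hom
    ((hD.shortExact p).homology_exact₃ 0 1 rfl).gIsCokernel
    (mapCyclesShortComplex_exact (HomologicalComplex.homologyFunctor B _ 0) D p).gIsCokernel
    WalkingParallelPair.one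

lemma edgeIsoOne_naturality (φ : D ⟶ D') (p : ℕ) :
    HomologicalComplex.homologyMap (HomologicalComplex.cyclesMap φ p) 1 ≫
        (hD'.edgeIsoOne p).hom =
      (hD.edgeIsoOne p).hom ≫
        HomologicalComplex.homologyMap (homologyZeroComplex.map φ) (p + 1) := by
  refine (cancel_epi (hD.connecting p 0)).mp ?_
  refine ((reassoc_of% connecting_naturality hD hD' φ p 0) _).trans ?_
  refine (_ ≫= hD'.connecting_edgeIsoOne_hom p).trans ?_
  refine (mapCyclesShortComplex_g_naturality
    (HomologicalComplex.homologyFunctor B _ 0) φ p).trans ?_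
  exact ((reassoc_of% hD.connecting_edgeIsoOne_hom p) _).symm

/-- The isomorphism `Hⁿ⁺¹ (Zᵖ D) ≅ Hᵖ⁺ⁿ⁺¹ (H⁰ D)` obtained by shifting the degree along the
connecting homomorphisms. -/
noncomputable def edgeIso : ∀ (n p m : ℕ), p + n + 1 = m →
    ((D.cycles p).homology (n + 1) ≅ (homologyZeroComplex.obj D).homology m)
  | 0, p, _, rfl => hD.edgeIsoOne p
  | n + 1, p, m, h =>
    (asIso (hD.connecting p (n + 1))).symm ≪≫ edgeIso n (p + 1) m (by omega)

lemma edgeIso_naturality (φ : D ⟶ D') (n p m : ℕ) (h : p + n + 1 = m) :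
    HomologicalComplex.homologyMap (HomologicalComplex.cyclesMap φ p) (n + 1) ≫
        (hD'.edgeIso n p m h).hom =
      (hD.edgeIso n p m h).hom ≫
        HomologicalComplex.homologyMap (homologyZeroComplex.map φ) m := by
  induction n generalizing p with
  | zero =>
    subst h
    exact edgeIsoOne_naturality hD hD' φ p
  | succ n ih =>
    have h' := ih (p + 1) (by omega)
    simp only [edgeIso, Iso.trans_hom, Iso.symm_hom, asIso_inv, Category.assoc]
    rw [← h', ← cancel_epi (hD.connecting p (n + 1)), IsIso.hom_inv_id_assoc,
      reassoc_of% connecting_naturality hD hD', IsIso.hom_inv_id_assoc]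

end IsEdgeExact

end Bicomplex

/-! ### Right derived functors from exact functors to complexes -/

section ExactComplex

variable {A B : Type*} [Category* A] [Category* B] [Abelian A] [Abelian B]

lemma exactAt_mapHomologicalComplex (K : A ⥤ B) [K.Additive] [K.PreservesHomology]
    {D : CochainComplex A ℕ} {p : ℕ} (h : D.ExactAt p) :
    ((K.mapHomologicalComplex (ComplexShape.up ℕ)).obj D).ExactAt p :=
  ShortComplex.Exact.map h K

/-- An exact functor to cochain complexes which sends injective objects to complexes that are exact
in positive degrees. -/
structure IsResolving (K : A ⥤ CochainComplex B ℕ) : Prop where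
  preservesFiniteLimits : PreservesFiniteLimits K
  preservesHomology : K.PreservesHomology
  exactAt_succ (I : A) [Injective I] (q : ℕ) : (K.obj I).ExactAt (q + 1)

variable {K K' : A ⥤ CochainComplex B ℕ} [K.Additive] [K'.Additive]

lemma IsResolving.isEdgeExact (hK : IsResolving K) {X : A} (I : InjectiveResolution X) :
    IsEdgeExact ((K.mapHomologicalComplex (ComplexShape.up ℕ)).obj I.cocomplex) where
  exactAt_succ p :=
    have := hK.preservesHomology
    exactAt_mapHomologicalComplex K (I.cocomplex_exactAt_succ p)
  exactAt_X_succ _ q := hK.exactAt_succ _ q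

/-- The isomorphism of complexes `L D ≅ H⁰ (K D)` given by an isomorphism `L ≅ H⁰ ∘ K`. -/
noncomputable def homologyZeroComplexIso {L : A ⥤ B} [L.Additive]
    (e : L ≅ K ⋙ HomologicalComplex.homologyFunctor B _ 0) (D : CochainComplex A ℕ) :
    (L.mapHomologicalComplex (ComplexShape.up ℕ)).obj D ≅
      homologyZeroComplex.obj ((K.mapHomologicalComplex (ComplexShape.up ℕ)).obj D) :=
  HomologicalComplex.Hom.isoOfComponents (fun _ => e.app _)
    (fun _ _ _ => (e.hom.naturality _).symm)

/-- Naturality in the complex `D` and in the functor `K` at once, for a fixed functor `L`. -/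
lemma homologyZeroComplexIso_hom_naturality {L : A ⥤ B} [L.Additive]
    (e : L ≅ K ⋙ HomologicalComplex.homologyFunctor B _ 0)
    (e' : L ≅ K' ⋙ HomologicalComplex.homologyFunctor B _ 0) (τ : K ⟶ K')
    (hτ : e.hom ≫ Functor.whiskerRight τ _ = e'.hom) {D D' : CochainComplex A ℕ} (φ : D ⟶ D') :
    (L.mapHomologicalComplex (ComplexShape.up ℕ)).map φ ≫ (homologyZeroComplexIso e' D').hom =
      (homologyZeroComplexIso e D).hom ≫ homologyZeroComplex.map
        ((K.mapHomologicalComplex (ComplexShape.up ℕ)).map φ ≫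
          (NatTrans.mapHomologicalComplex τ (ComplexShape.up ℕ)).app D') := by
  ext p
  have h : e.hom.app (D'.X p) ≫ HomologicalComplex.homologyMap (τ.app (D'.X p)) 0 =
      e'.hom.app (D'.X p) := congr($(hτ).app (D'.X p))
  refine (_ ≫= h.symm).trans ?_
  refine (Category.assoc _ _ _).symm.trans ?_
  refine (e.hom.naturality (φ.f p) =≫ _).trans ?_
  refine (Category.assoc _ _ _).trans ?_
  exact _ ≫= (HomologicalComplex.homologyMap_comp (K.map (φ.f p)) (τ.app (D'.X p)) 0).symm

/-- Naturality of the augmentation `K X ⟶ Z⁰ (K I)` in the object `X` and in the functor `K` at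
once. -/
lemma toRightDerivedZero'_naturality_functor (τ : K ⟶ K') {X Y : A} (f : X ⟶ Y)
    (I : InjectiveResolution X) (J : InjectiveResolution Y) (φ : I.cocomplex ⟶ J.cocomplex)
    (comm : I.ι.f 0 ≫ φ.f 0 = f ≫ J.ι.f 0) :
    (K.map f ≫ τ.app Y) ≫ J.toRightDerivedZero' K' =
      I.toRightDerivedZero' K ≫
        HomologicalComplex.cyclesMap ((K.mapHomologicalComplex (ComplexShape.up ℕ)).map φ ≫
          (NatTrans.mapHomologicalComplex τ (ComplexShape.up ℕ)).app J.cocomplex) 0 := by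
  have h : τ.app Y ≫ J.toRightDerivedZero' K' = J.toRightDerivedZero' K ≫
      HomologicalComplex.cyclesMap
        ((NatTrans.mapHomologicalComplex τ (ComplexShape.up ℕ)).app J.cocomplex) 0 := by
    refine (cancel_mono (HomologicalComplex.iCycles _ 0)).mp ?_
    refine (Category.assoc _ _ _).trans ?_
    refine (_ ≫= J.toRightDerivedZero'_comp_iCycles K').trans ?_
    refine (τ.naturality _).symm.trans ?_
    rw [Category.assoc, HomologicalComplex.cyclesMap_i]
    exact (J.toRightDerivedZero'_comp_iCycles_assoc K _).symm
  rw [Category.assoc, h, HomologicalComplex.cyclesMap_comp,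
    InjectiveResolution.toRightDerivedZero'_naturality_assoc f I J φ comm K]

variable [EnoughInjectives A]

/-- For a resolving functor `K` with `L ≅ H⁰ ∘ K`, the complex `K X` computes the right derived
functors of `L` in positive degrees. With an injective resolution `I` of `X`, the isomorphism is
`Rⁿ⁺¹ L X ≅ Hⁿ⁺¹ (L I) ≅ Hⁿ⁺¹ (H⁰ (K I)) ≅ Hⁿ⁺¹ (Z⁰ (K I)) ≅ Hⁿ⁺¹ (K X)`. -/
noncomputable def IsResolving.rightDerivedIso (hK : IsResolving K) {L : A ⥤ B} [L.Additive]
    (e : L ≅ K ⋙ HomologicalComplex.homologyFunctor B _ 0) (n : ℕ) (X : A) :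
    (L.rightDerived (n + 1)).obj X ≅ (K.obj X).homology (n + 1) :=
  have := hK.preservesFiniteLimits
  (injectiveResolution X).isoRightDerivedObj L (n + 1) ≪≫
    (HomologicalComplex.homologyFunctor B _ (n + 1)).mapIso (homologyZeroComplexIso e _) ≪≫
    ((hK.isEdgeExact (injectiveResolution X)).edgeIso n 0 (n + 1) (by omega)).symm ≪≫
    ((HomologicalComplex.homologyFunctor B _ (n + 1)).mapIso
      (asIso ((injectiveResolution X).toRightDerivedZero' K))).symm

/-- Naturality in the object `X` and in the functor `K` at once: `K X ⟶ K' Y` is the map induced by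
`f` and `τ`. -/
lemma IsResolving.rightDerivedIso_naturality (hK : IsResolving K) (hK' : IsResolving K')
    {L : A ⥤ B} [L.Additive]
    (e : L ≅ K ⋙ HomologicalComplex.homologyFunctor B _ 0)
    (e' : L ≅ K' ⋙ HomologicalComplex.homologyFunctor B _ 0) (τ : K ⟶ K')
    (hτ : e.hom ≫ Functor.whiskerRight τ _ = e'.hom) (n : ℕ) {X Y : A} (f : X ⟶ Y) :
    (L.rightDerived (n + 1)).map f ≫ (hK'.rightDerivedIso e' n Y).hom =
      (hK.rightDerivedIso e n X).hom ≫
        HomologicalComplex.homologyMap (K.map f ≫ τ.app Y) (n + 1) := by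
  have := hK.preservesFiniteLimits
  have := hK'.preservesFiniteLimits
  let I := injectiveResolution X
  let J := injectiveResolution Y
  let φ : I.cocomplex ⟶ J.cocomplex := InjectiveResolution.desc f J I
  have comm : I.ι.f 0 ≫ φ.f 0 = f ≫ J.ι.f 0 := InjectiveResolution.desc_commutes_zero f J I
  let Φ := (K.mapHomologicalComplex (ComplexShape.up ℕ)).map φ ≫
          (NatTrans.mapHomologicalComplex τ (ComplexShape.up ℕ)).app J.cocomplex
  have h₁ : CommSq (I.isoRightDerivedObj L (n + 1)).hom ((L.rightDerived (n + 1)).map f) _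
      (J.isoRightDerivedObj L (n + 1)).hom :=
    ⟨(InjectiveResolution.isoRightDerivedObj_hom_naturality f I J φ comm L (n + 1)).symm⟩
  have h₂ := (CommSq.mk (homologyZeroComplexIso_hom_naturality e e' τ hτ φ).symm).map
    (HomologicalComplex.homologyFunctor B _ (n + 1))
  have h₃ : CommSq ((hK.isEdgeExact I).edgeIso n 0 (n + 1) (by omega)).hom _ _
      ((hK'.isEdgeExact J).edgeIso n 0 (n + 1) (by omega)).hom :=
    ⟨((hK.isEdgeExact I).edgeIso_naturality (hK'.isEdgeExact J) Φ n 0 (n + 1) (by omega)).symm⟩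
  have h₄ : CommSq (asIso (I.toRightDerivedZero' K)).hom (K.map f ≫ τ.app Y) _
      (asIso (J.toRightDerivedZero' K')).hom :=
    ⟨(toRightDerivedZero'_naturality_functor τ f I J φ comm).symm⟩
  exact (h₁.horiz_comp (h₂.horiz_comp (h₃.horiz_inv.horiz_comp
    (h₄.horiz_inv.map (HomologicalComplex.homologyFunctor B _ (n + 1)))))).w.symm

end ExactComplex

/-! ### The standard complex and limits -/

section StandardCochain

variable {C : Type u} [Category.{v} C] [HasBinaryCoproducts C]

/-- The coface map `(i_{δⁱ 0}, …, i_{δⁱ n})` of the standard cosimplicial object. -/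
noncomputable def copowerCoface (c : C) (n : ℕ) (i : Fin (n + 2)) :
    copower c n ⟶ copower c (n + 1) :=
  Sigma.desc fun j => Sigma.ι (fun _ : Fin (n + 2) => c) (i.succAbove j)

@[simp]
lemma ι_copowerCoface (c : C) (n : ℕ) (i : Fin (n + 2)) (j : Fin (n + 1)) :
    Sigma.ι (fun _ : Fin (n + 1) => c) j ≫ copowerCoface c n i =
      Sigma.ι (fun _ : Fin (n + 2) => c) (i.succAbove j) :=
  Sigma.ι_desc ..

@[simp]
lemma ι_copowerCoface_assoc (c : C) (n : ℕ) (i : Fin (n + 2)) (j : Fin (n + 1)) {d : C}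
    (x : copower c (n + 1) ⟶ d) :
    Sigma.ι (fun _ : Fin (n + 1) => c) j ≫ copowerCoface c n i ≫ x =
      Sigma.ι (fun _ : Fin (n + 2) => c) (i.succAbove j) ≫ x := by
  rw [← Category.assoc, ι_copowerCoface]

variable (C) in
/-- The functor `c ↦ (F ↦ C F B(c))`, where `C F B(c)` is the alternate sum complex. -/
noncomputable def standardCochain :
    C ⥤ (C ⥤ AddCommGrpCat.{w}) ⥤ CochainComplex AddCommGrpCat.{w} ℕ :=
  standardComplex C ⋙ Functor.whiskeringLeft SimplexCategory C AddCommGrpCat.{w} ⋙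
    (Functor.whiskeringRight _ _ _).obj
      (AlgebraicTopology.alternatingCofaceMapComplex AddCommGrpCat.{w})

/-- The complex `C F B(c)`. -/
noncomputable abbrev standardCochainObj (c : C) (F : C ⥤ AddCommGrpCat.{w}) :
    CochainComplex AddCommGrpCat.{w} ℕ :=
  ((standardCochain C).obj c).obj F

lemma standardCochain_map_comp_id (c : C) {F G : C ⥤ AddCommGrpCat.{w}} (α : F ⟶ G) :
    ((standardCochain.{w} C).obj c).map α ≫ ((standardCochain.{w} C).map (𝟙 c)).app G =
      ((standardCochain.{w} C).obj c).map α := by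
  rw [CategoryTheory.Functor.map_id, NatTrans.id_app, Category.comp_id]

lemma standardCochain_id_comp_map {c c' : C} (f : c ⟶ c') (F : C ⥤ AddCommGrpCat.{w}) :
    ((standardCochain.{w} C).obj c).map (𝟙 F) ≫ ((standardCochain.{w} C).map f).app F =
      ((standardCochain.{w} C).map f).app F := by
  rw [CategoryTheory.Functor.map_id, Category.id_comp]

instance (c : C) : ((standardCochain.{w} C).obj c).Additive where
  map_add {F G f g} := by
    ext p : 1
    rfl

lemma standardCochain_shortExact (c : C) {S : ShortComplex (C ⥤ AddCommGrpCat.{w})}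
    (hS : S.ShortExact) : (S.map ((standardCochain.{w} C).obj c)).ShortExact :=
  HomologicalComplex.shortExact_of_degreewise_shortExact _ fun p =>
    hS.map_of_exact ((evaluation C AddCommGrpCat.{w}).obj (copower c p))

lemma preservesHomology_standardCochain (c : C) :
    ((standardCochain.{w} C).obj c).PreservesHomology :=
  ((Functor.exact_tfae ((standardCochain.{w} C).obj c)).out 0 2).mp
    fun _ hS => standardCochain_shortExact c hS

lemma preservesFiniteLimits_standardCochain (c : C) :
    PreservesFiniteLimits ((standardCochain.{w} C).obj c) := by
  have h : PreservesFiniteLimits ((standardCochain.{w} C).obj c) ∧ _ :=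
    ((Functor.exact_tfae ((standardCochain.{w} C).obj c)).out 0 3).mp
      fun _ hS => standardCochain_shortExact c hS
  exact h.1

/-- The differential of the complex `C F B(c)`, as a morphism between values of `F`. -/
noncomputable def standardCochainD (c : C) (F : C ⥤ AddCommGrpCat.{w}) (n : ℕ) :
    F.obj (copower c n) ⟶ F.obj (copower c (n + 1)) :=
  ∑ i : Fin (n + 2), (-1 : ℤ) ^ (i : ℕ) • F.map (copowerCoface c n i)

lemma standardCochain_d (c : C) (F : C ⥤ AddCommGrpCat.{w}) (n : ℕ) :
    (standardCochainObj c F).d n (n + 1) = standardCochainD c F n :=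
  CochainComplex.of_d
    (fun n => (((standardComplex C).obj c) ⋙ F).obj (SimplexCategory.mk n))
    (AlgebraicTopology.AlternatingCofaceMapComplex.objD ((standardComplex C).obj c ⋙ F)) n

lemma standardCochainD_zero (c : C) (F : C ⥤ AddCommGrpCat.{w}) :
    standardCochainD c F 0 = F.map (copowerCoface c 0 0) - F.map (copowerCoface c 0 1) := by
  simp [standardCochainD, Fin.sum_univ_succ, sub_eq_add_neg]

end StandardCochain

section Lim

variable {C : Type u} [Category.{v} C] [HasBinaryCoproducts C]

/-- Two morphisms out of `B(c)⁰` factor simultaneously through the two coface maps to `B(c)¹`. -/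
lemma exists_copowerCoface_comp {c d : C} (g h : copower c 0 ⟶ d) :
    ∃ k : copower c 1 ⟶ d, copowerCoface c 0 0 ≫ k = g ∧ copowerCoface c 0 1 ≫ k = h := by
  refine ⟨Sigma.desc ![Sigma.ι (fun _ : Fin 1 => c) 0 ≫ h, Sigma.ι (fun _ : Fin 1 => c) 0 ≫ g],
    ?_, ?_⟩
  · refine Sigma.hom_ext _ _ fun j => ?_
    obtain rfl : j = 0 := Fin.fin_one_eq_zero j
    rw [ι_copowerCoface_assoc]
    exact Sigma.ι_desc _ _
  · refine Sigma.hom_ext _ _ fun j => ?_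
    obtain rfl : j = 0 := Fin.fin_one_eq_zero j
    rw [ι_copowerCoface_assoc]
    exact Sigma.ι_desc _ _

/-- The inclusion of the cocycles in degree `0` of `C F B(c)` into `F (B(c)⁰)`. It is `iCycles` with
its codomain written as a value of `F`, so that it can be composed with the maps `F.map g`. -/
noncomputable def zeroCocycles (c : C) (F : C ⥤ AddCommGrpCat.{w}) :
    (standardCochainObj c F).cycles 0 ⟶ F.obj (copower c 0) :=
  (standardCochainObj c F).iCycles 0

instance (c : C) (F : C ⥤ AddCommGrpCat.{w}) : Mono (zeroCocycles c F) :=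
  inferInstanceAs (Mono ((standardCochainObj c F).iCycles 0))

lemma zeroCocycles_d (c : C) (F : C ⥤ AddCommGrpCat.{w}) :
    zeroCocycles c F ≫ standardCochainD c F 0 = 0 :=
  (zeroCocycles c F ≫= standardCochain_d c F 0).symm.trans
    ((standardCochainObj c F).iCycles_d 0 1)

/-- The two coface maps `B(c)⁰ ⟶ B(c)¹` agree on cocycles, and any two morphisms out of `B(c)⁰`
factor through them. -/
lemma zeroCocycles_map_eq (c : C) (F : C ⥤ AddCommGrpCat.{w}) {d : C} (g h : copower c 0 ⟶ d) :
    zeroCocycles c F ≫ F.map g = zeroCocycles c F ≫ F.map h := by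
  obtain ⟨k, rfl, rfl⟩ := exists_copowerCoface_comp g h
  have hd := zeroCocycles_d c F
  rw [standardCochainD_zero, Preadditive.comp_sub, sub_eq_zero] at hd
  rw [F.map_comp, F.map_comp, reassoc_of% hd]

lemma zeroCocycles_naturality {c c' : C} (f : c ⟶ c') {F G : C ⥤ AddCommGrpCat.{w}} (α : F ⟶ G) :
    HomologicalComplex.cyclesMap
        (((standardCochain.{w} C).obj c).map α ≫ ((standardCochain.{w} C).map f).app G) 0 ≫
      zeroCocycles c' G =
    zeroCocycles c F ≫ α.app (copower c 0) ≫
      G.map (Limits.Sigma.map fun _ => f : copower c 0 ⟶ copower c' 0) :=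
  HomologicalComplex.cyclesMap_i
    (((standardCochain.{w} C).obj c).map α ≫ ((standardCochain.{w} C).map f).app G) 0

variable [IsStronglyConnected C]

lemma limit_π_standardCochainD (c : C) (F : C ⥤ AddCommGrpCat.{w}) :
    limit.π F (copower c 0) ≫ standardCochainD c F 0 = 0 := by
  rw [standardCochainD_zero, Preadditive.comp_sub, limit.w, limit.w, sub_self]

/-- The map `lim F ⟶ Z⁰ (F B(c))`. -/
noncomputable def limToCycles (c : C) (F : C ⥤ AddCommGrpCat.{w}) :
    limit F ⟶ (standardCochainObj c F).cycles 0 :=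
  HomologicalComplex.liftCycles _ (limit.π F (copower c 0)) 1 (by simp)
    ((limit.π F (copower c 0) ≫= standardCochain_d c F 0).trans (limit_π_standardCochainD c F))

lemma limToCycles_zeroCocycles (c : C) (F : C ⥤ AddCommGrpCat.{w}) :
    limToCycles c F ≫ zeroCocycles c F = limit.π F (copower c 0) :=
  HomologicalComplex.liftCycles_i ..

instance (c : C) (F : C ⥤ AddCommGrpCat.{w}) : IsIso (limToCycles c F) := by
  -- The image of a cocycle in `F d` does not depend on the chosen morphism `g d`, so that the
  -- cocycles form a cone over `F`.
  have g (d : C) : copower c 0 ⟶ d :=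
    (IsStronglyConnected.nonempty_hom (copower c 0) d).some
  let s : Cone F :=
    { pt := (standardCochainObj c F).cycles 0
      π :=
        { app d := zeroCocycles c F ≫ F.map (g d)
          naturality d d' f := by
            simp [zeroCocycles_map_eq c F (g d') (g d ≫ f)] } }
  refine ⟨limit.lift F s, ?_, ?_⟩
  · refine limit.hom_ext fun d => ?_
    rw [Category.assoc, limit.lift_π, Category.id_comp,
      reassoc_of% limToCycles_zeroCocycles c F, limit.w]
  · rw [← cancel_mono (zeroCocycles c F), Category.assoc, limToCycles_zeroCocycles,
      limit.lift_π, Category.id_comp]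
    refine (zeroCocycles_map_eq c F (g (copower c 0)) (𝟙 _)).trans ?_
    rw [F.map_id, Category.comp_id]

lemma limToCycles_naturality {c c' : C} (f : c ⟶ c') {F G : C ⥤ AddCommGrpCat.{w}} (α : F ⟶ G) :
    lim.map α ≫ limToCycles c' G = limToCycles c F ≫ HomologicalComplex.cyclesMap
      (((standardCochain.{w} C).obj c).map α ≫ ((standardCochain.{w} C).map f).app G) 0 := by
  rw [← cancel_mono (zeroCocycles c' G), Category.assoc, Category.assoc, zeroCocycles_naturality,
    limToCycles_zeroCocycles, reassoc_of% limToCycles_zeroCocycles c F, lim_map, limMap_π,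
    ← α.naturality, limit.w_assoc]

/-- The component at `F` of the isomorphism `lim F ≅ H⁰ (F B(c))`. -/
noncomputable def limIsoApp (c : C) (F : C ⥤ AddCommGrpCat.{w}) :
    limit F ≅ (standardCochainObj c F).homology 0 :=
  asIso (limToCycles c F) ≪≫ CochainComplex.isoHomologyπ₀ (standardCochainObj c F)

lemma limIsoApp_naturality {c c' : C} (f : c ⟶ c') {F G : C ⥤ AddCommGrpCat.{w}} (α : F ⟶ G) :
    lim.map α ≫ (limIsoApp c' G).hom = (limIsoApp c F).hom ≫ HomologicalComplex.homologyMap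
      (((standardCochain.{w} C).obj c).map α ≫ ((standardCochain.{w} C).map f).app G) 0 := by
  refine (Category.assoc ..).symm.trans ((limToCycles_naturality f α =≫ _).trans ?_)
  refine (Category.assoc ..).trans (Eq.trans (_ ≫= ?_) (Category.assoc ..).symm)
  exact (HomologicalComplex.homologyπ_naturality _ 0).symm

/-- Limits are computed by `H⁰ (F B(c))`. -/
noncomputable def limIso (c : C) : (lim : (C ⥤ AddCommGrpCat.{w}) ⥤ AddCommGrpCat.{w}) ≅
    (standardCochain.{w} C).obj c ⋙
      HomologicalComplex.homologyFunctor AddCommGrpCat.{w} (ComplexShape.up ℕ) 0 :=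
  NatIso.ofComponents (limIsoApp c) fun α =>
    (limIsoApp_naturality (𝟙 c) α).trans
      (_ ≫= congrArg (HomologicalComplex.homologyMap · 0) (standardCochain_map_comp_id c α))

lemma limIso_naturality {c c' : C} (f : c ⟶ c') :
    (limIso.{w} c).hom ≫ Functor.whiskerRight ((standardCochain.{w} C).map f) _ =
      (limIso.{w} c').hom := by
  ext F : 2
  have h := limIsoApp_naturality f (𝟙 F)
  rw [CategoryTheory.Functor.map_id, Category.id_comp, standardCochain_id_comp_map] at h
  exact h.symm

end Lim

/-! ### Vanishing on injective functors -/

lemma exact_of_evaluation {J A : Type*} [Category* J] [Category* A] [Abelian A]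
    (S : ShortComplex (J ⥤ A)) (h : ∀ j, (S.map ((evaluation J A).obj j)).Exact) : S.Exact := by
  rw [ShortComplex.exact_iff_isZero_homology, Functor.isZero_iff]
  exact fun j => ((S.map _).exact_iff_isZero_homology.mp (h j)).of_iso
    (S.mapHomologyIso ((evaluation J A).obj j)).symm

section CopowerCons

variable {C : Type u} [Category.{v} C] [HasBinaryCoproducts C]

/-- The operator `(x₀, …, xₙ) ↦ (g, x₀, …, xₙ)` on tuples of morphisms. -/
noncomputable def copowerCons {c d : C} (g : c ⟶ d) (n : ℕ) (x : copower c n ⟶ d) :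
    copower c (n + 1) ⟶ d :=
  Sigma.desc (Fin.cons g fun j => Sigma.ι (fun _ : Fin (n + 1) => c) j ≫ x)

lemma copowerCoface_zero_copowerCons {c d : C} (g : c ⟶ d) (n : ℕ) (x : copower c n ⟶ d) :
    copowerCoface c n 0 ≫ copowerCons g n x = x := by
  refine Sigma.hom_ext _ _ fun j => ?_
  simp [copowerCons]

lemma copowerCoface_succ_copowerCons {c d : C} (g : c ⟶ d) (n : ℕ) (x : copower c (n + 1) ⟶ d)
    (i : Fin (n + 2)) :
    copowerCoface c (n + 1) i.succ ≫ copowerCons g (n + 1) x =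
      copowerCons g n (copowerCoface c n i ≫ x) := by
  refine Sigma.hom_ext _ _ fun j => ?_
  refine Fin.cases ?_ (fun j => ?_) j <;> simp [copowerCons]

end CopowerCons

section FreeCoyoneda

variable (C : Type u) [Category.{v} C] [LocallySmall.{w} C]

/-- The functor `c ↦ ℤ[Hom(c, -)]`. The hom-sets are replaced by their models in `Type w`, so that
the values lie in the same category of abelian groups as those of the functors `C ⥤ Ab`. -/
noncomputable def freeCoyoneda : Cᵒᵖ ⥤ C ⥤ AddCommGrpCat.{w} where
  obj c :=
    { obj d := AddCommGrpCat.of (FreeAbelianGroup (Shrink.{w} (c.unop ⟶ d)))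
      map {d d'} f := AddCommGrpCat.ofHom (FreeAbelianGroup.map fun x =>
        equivShrink _ ((equivShrink _).symm x ≫ f))
      map_id d := by
        ext : 1
        apply FreeAbelianGroup.lift_ext
        simp
      map_comp f g := by
        ext : 1
        apply FreeAbelianGroup.lift_ext
        simp }
  map {c c'} f :=
    { app d := AddCommGrpCat.ofHom (FreeAbelianGroup.map fun x =>
        equivShrink _ (f.unop ≫ (equivShrink _).symm x))
      naturality d d' g := by
        ext : 1
        apply FreeAbelianGroup.lift_ext
        simp }
  map_id c := by
    ext d : 3
    apply FreeAbelianGroup.lift_ext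
    simp
  map_comp f g := by
    ext d : 3
    apply FreeAbelianGroup.lift_ext
    simp

variable {C}

lemma freeCoyoneda_map_app_of {c c' : C} (f : c ⟶ c') (d : C) (g : c' ⟶ d) :
    ((freeCoyoneda.{w} C).map f.op).app d (FreeAbelianGroup.of (equivShrink _ g)) =
      FreeAbelianGroup.of (equivShrink _ (f ≫ g)) := by
  refine (FreeAbelianGroup.map_of_apply _).trans ?_
  simp

/-- The Yoneda isomorphism `Hom(ℤ[Hom(c, -)], F) ≃ F c`. -/
noncomputable def freeCoyonedaEquiv (c : C) (F : C ⥤ AddCommGrpCat.{w}) :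
    ((freeCoyoneda.{w} C).obj (op c) ⟶ F) ≃+ F.obj c where
  toFun ψ := ψ.app c (FreeAbelianGroup.of (equivShrink _ (𝟙 c)))
  invFun x :=
    { app d := AddCommGrpCat.ofHom (FreeAbelianGroup.lift fun g =>
        F.map ((equivShrink _).symm g) x)
      naturality d d' f := by
        ext : 1
        apply FreeAbelianGroup.lift_ext
        simp [freeCoyoneda] }
  left_inv ψ := by
    ext d : 3
    apply FreeAbelianGroup.lift_ext
    intro g
    obtain ⟨g, rfl⟩ := (equivShrink _).surjective g
    have h := ψ.naturality_apply g (FreeAbelianGroup.of (equivShrink _ (𝟙 c)))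
    have h' : ((freeCoyoneda.{w} C).obj (op c)).map g
        (FreeAbelianGroup.of (equivShrink _ (𝟙 c))) = FreeAbelianGroup.of (equivShrink _ g) :=
      (FreeAbelianGroup.map_of_apply _).trans (by simp)
    rw [h'] at h
    refine (FreeAbelianGroup.lift_apply_of _ _).trans (Eq.trans ?_ h.symm)
    simp
  right_inv x := (FreeAbelianGroup.lift_apply_of _ _).trans (by simp)
  map_add' _ _ := rfl

lemma freeCoyonedaEquiv_naturality {c c' : C} (f : c ⟶ c') {F : C ⥤ AddCommGrpCat.{w}}
    (ψ : (freeCoyoneda.{w} C).obj (op c) ⟶ F) :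
    freeCoyonedaEquiv c' F ((freeCoyoneda.{w} C).map f.op ≫ ψ) =
      F.map f (freeCoyonedaEquiv c F ψ) := by
  obtain ⟨x, rfl⟩ := (freeCoyonedaEquiv c F).symm.surjective ψ
  rw [AddEquiv.apply_symm_apply]
  refine (congrArg (((freeCoyonedaEquiv c F).symm x).app c')
    (freeCoyoneda_map_app_of f c' (𝟙 c'))).trans ?_
  exact (FreeAbelianGroup.lift_apply_of _ _).trans (by simp)

variable [HasBinaryCoproducts C]

/-- The differential `ℤ[Hom(B(c)ⁿ⁺¹, -)] ⟶ ℤ[Hom(B(c)ⁿ, -)]`. -/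
noncomputable def freeCoyonedaD (c : C) (n : ℕ) :
    (freeCoyoneda.{w} C).obj (op (copower c (n + 1))) ⟶
      (freeCoyoneda.{w} C).obj (op (copower c n)) :=
  ∑ i : Fin (n + 2), (-1 : ℤ) ^ (i : ℕ) • (freeCoyoneda.{w} C).map (copowerCoface c n i).op

lemma freeCoyonedaD_comp (c : C) (n : ℕ) :
    freeCoyonedaD.{w} c (n + 1) ≫ freeCoyonedaD c n = 0 :=
  AlgebraicTopology.AlternatingFaceMapComplex.d_squared
    (((standardComplex C).obj c).op ⋙ freeCoyoneda.{w} C : SimplicialObject _) n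

lemma freeCoyonedaEquiv_freeCoyonedaD (c : C) (n : ℕ) (F : C ⥤ AddCommGrpCat.{w})
    (ψ : (freeCoyoneda.{w} C).obj (op (copower c n)) ⟶ F) :
    freeCoyonedaEquiv _ F (freeCoyonedaD c n ≫ ψ) =
      standardCochainD c F n (freeCoyonedaEquiv _ F ψ) := by
  let ev : (F.obj (copower c n) ⟶ F.obj (copower c (n + 1))) →+ F.obj (copower c (n + 1)) :=
    { toFun f := f (freeCoyonedaEquiv _ F ψ)
      map_zero' := rfl
      map_add' _ _ := rfl }
  have h : ev (standardCochainD c F n) = _ := map_sum ev _ _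
  refine Eq.trans ?_ h.symm
  simp only [freeCoyonedaD, Preadditive.sum_comp, Preadditive.zsmul_comp, map_sum, map_zsmul,
    freeCoyonedaEquiv_naturality]
  rfl

/-- The contraction of `ℤ[Hom(B(c), d)]` given by a morphism `g : c ⟶ d`. -/
noncomputable def freeCoyonedaContraction {c d : C} (g : c ⟶ d) (n : ℕ) :
    ((freeCoyoneda.{w} C).obj (op (copower c n))).obj d ⟶
      ((freeCoyoneda.{w} C).obj (op (copower c (n + 1)))).obj d :=
  AddCommGrpCat.ofHom (FreeAbelianGroup.map fun x =>
    equivShrink _ (copowerCons g n ((equivShrink _).symm x)))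

lemma freeCoyonedaContraction_coface_zero {c d : C} (g : c ⟶ d) (n : ℕ) :
    freeCoyonedaContraction.{w} g n ≫ ((freeCoyoneda.{w} C).map (copowerCoface c n 0).op).app d =
      𝟙 _ := by
  ext : 1
  apply FreeAbelianGroup.lift_ext
  intro x
  refine (congrArg (FreeAbelianGroup.map _) (FreeAbelianGroup.map_of_apply _)).trans ?_
  refine (FreeAbelianGroup.map_of_apply _).trans ?_
  simp [copowerCoface_zero_copowerCons]
  rfl

lemma freeCoyonedaContraction_coface_succ {c d : C} (g : c ⟶ d) (n : ℕ) (i : Fin (n + 2)) :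
    freeCoyonedaContraction.{w} g (n + 1) ≫
        ((freeCoyoneda.{w} C).map (copowerCoface c (n + 1) i.succ).op).app d =
      ((freeCoyoneda.{w} C).map (copowerCoface c n i).op).app d ≫
        freeCoyonedaContraction g n := by
  ext : 1
  apply FreeAbelianGroup.lift_ext
  intro x
  refine (congrArg (FreeAbelianGroup.map _) (FreeAbelianGroup.map_of_apply _)).trans ?_
  refine (FreeAbelianGroup.map_of_apply _).trans (Eq.symm ?_)
  refine (congrArg (FreeAbelianGroup.map _) (FreeAbelianGroup.map_of_apply _)).trans ?_
  refine (FreeAbelianGroup.map_of_apply _).trans ?_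
  simp [copowerCoface_succ_copowerCons]

lemma freeCoyonedaContraction_homotopy {c d : C} (g : c ⟶ d) (n : ℕ) :
    freeCoyonedaContraction.{w} g (n + 1) ≫ (freeCoyonedaD c (n + 1)).app d +
      (freeCoyonedaD c n).app d ≫ freeCoyonedaContraction g n = 𝟙 _ := by
  simp [freeCoyonedaD, Fin.sum_univ_succ (n := n + 2), Preadditive.comp_sum, Preadditive.sum_comp,
    freeCoyonedaContraction_coface_zero, freeCoyonedaContraction_coface_succ,
    pow_succ, NatTrans.app_sum]

/-- Exactness is checked at each object `d`, where a morphism `c ⟶ d` gives a contraction. -/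
lemma freeCoyonedaD_exact [IsStronglyConnected C] (c : C) (n : ℕ) :
    (ShortComplex.mk _ _ (freeCoyonedaD_comp.{w} c n)).Exact := by
  refine exact_of_evaluation _ fun d => ?_
  rw [ShortComplex.ab_exact_iff]
  intro x hx
  obtain ⟨g⟩ := IsStronglyConnected.nonempty_hom c d
  have h := congr($(freeCoyonedaContraction_homotopy.{w} g n) x)
  refine ⟨freeCoyonedaContraction.{w} g (n + 1) x, ?_⟩
  have hx' : freeCoyonedaContraction.{w} g n ((freeCoyonedaD c n).app d x) = 0 :=
    (congrArg _ hx).trans (map_zero _)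
  have h' : (freeCoyonedaD c (n + 1)).app d (freeCoyonedaContraction.{w} g (n + 1) x) +
      freeCoyonedaContraction.{w} g n ((freeCoyonedaD c n).app d x) = x := h
  rwa [hx', add_zero] at h'

/-- A cocycle of `C I B(c)` is a morphism `ℤ[Hom(B(c)ⁿ⁺¹, -)] ⟶ I` which vanishes on boundaries;
by exactness and injectivity of `I` it factors through the differential
`ℤ[Hom(B(c)ⁿ⁺¹, -)] ⟶ ℤ[Hom(B(c)ⁿ, -)]`. -/
lemma standardCochain_exactAt_succ [IsStronglyConnected C] (c : C) (I : C ⥤ AddCommGrpCat.{w})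
    [Injective I] (n : ℕ) : (standardCochainObj c I).ExactAt (n + 1) := by
  rw [HomologicalComplex.exactAt_iff' _ n (n + 1) (n + 2) (by simp) (by simp),
    ShortComplex.ab_exact_iff]
  intro (x : I.obj (copower c (n + 1))) hx
  have hx' : standardCochainD c I (n + 1) x = 0 :=
    congr($(standardCochain_d c I (n + 1)) x).symm.trans hx
  obtain ⟨ψ, rfl⟩ := (freeCoyonedaEquiv _ I).surjective x
  rw [← freeCoyonedaEquiv_freeCoyonedaD, AddEquiv.map_eq_zero_iff] at hx'
  refine ⟨freeCoyonedaEquiv (copower c n) I ((freeCoyonedaD_exact c n).descToInjective ψ hx'), ?_⟩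
  refine congr($(standardCochain_d c I n) _).trans ?_
  refine (freeCoyonedaEquiv_freeCoyonedaD ..).symm.trans ?_
  exact congrArg (freeCoyonedaEquiv _ I) ((freeCoyonedaD_exact c n).comp_descToInjective ψ hx')

end FreeCoyoneda

/-! ### Comparison with higher limits -/

section Comparison

variable {C : Type u} [Category.{v} C] [LocallySmall.{w} C] [IsStronglyConnected C]
  [HasBinaryCoproducts C]

lemma isResolving_standardCochain (c : C) : IsResolving ((standardCochain.{w} C).obj c) where
  preservesFiniteLimits := preservesFiniteLimits_standardCochain c
  preservesHomology := preservesHomology_standardCochain c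
  exactAt_succ I _ n := standardCochain_exactAt_succ c I n

variable [EnoughInjectives (C ⥤ AddCommGrpCat.{w})]

/-- The isomorphism `limⁿ F ≅ πⁿ F B(c)` for given `c` and `F`. Degree `0` is separate: there it is
the left exactness of `lim`, and no resolution of `F` is needed. -/
noncomputable def higherLimIsoApp (c : C) (F : C ⥤ AddCommGrpCat.{w}) : (n : ℕ) →
    ((higherLim C n).obj F ≅ (standardCochainObj c F).homology n)
  | 0 => lim.rightDerivedZeroIsoSelf.app F ≪≫ limIsoApp c F
  | n + 1 => (isResolving_standardCochain c).rightDerivedIso (limIso c) n F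

lemma higherLimIsoApp_naturality {c c' : C} (f : c ⟶ c') {F G : C ⥤ AddCommGrpCat.{w}} (α : F ⟶ G)
    (n : ℕ) :
    (higherLim C n).map α ≫ (higherLimIsoApp c' G n).hom =
      (higherLimIsoApp c F n).hom ≫ HomologicalComplex.homologyMap
        (((standardCochain.{w} C).obj c).map α ≫ ((standardCochain.{w} C).map f).app G) n := by
  cases n with
  | zero =>
    refine (Category.assoc ..).symm.trans
      ((lim.rightDerivedZeroIsoSelf.hom.naturality α =≫ _).trans ?_)
    refine (Category.assoc ..).trans (Eq.trans (_ ≫= ?_) (Category.assoc ..).symm)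
    exact limIsoApp_naturality f α
  | succ n =>
    exact (isResolving_standardCochain c).rightDerivedIso_naturality
      (isResolving_standardCochain c') (limIso c) (limIso c') ((standardCochain C).map f)
      (limIso_naturality f) n α

variable (C) in
/-- The isomorphism `limⁿ F ≅ πⁿ F B(c)`, natural in `c` and in `F`. -/
noncomputable def higherLimIso (n : ℕ) :
    (Functor.const C).obj (higherLim.{w} C n) ≅ standardCohomotopy.{w} C n :=
  NatIso.ofComponents
    (fun c => NatIso.ofComponents (fun F => higherLimIsoApp c F n) fun {F G} α =>
      (higherLimIsoApp_naturality (𝟙 c) α n).trans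
        (_ ≫= congrArg (HomologicalComplex.homologyMap · n)
          (standardCochain_map_comp_id c α)))
    fun {c c'} f => by
      ext F : 2
      have h := higherLimIsoApp_naturality f (𝟙 F) n
      rw [CategoryTheory.Functor.map_id, standardCochain_id_comp_map] at h
      exact h

end Comparison

end HigherLimits

open HigherLimits in
/-- The isomorphism `limⁿ F ≅ πⁿ F B(c)` is natural in the functor `F` and in the object `c`
(the left-hand side being constant in `c`). -/
theorem theorem2p9 (C : Type u) [Category.{v} C] [LocallySmall.{w} C]
    [IsStronglyConnected C] [HasBinaryCoproducts C]
    [EnoughInjectives (C ⥤ AddCommGrpCat.{w})] (n : ℕ) :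
    Nonempty ((Functor.const C).obj (higherLim.{w} C n) ≅ standardCohomotopy.{w} C n) :=
  ⟨higherLimIso C n⟩
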